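/- Let $n\ge 0$ and $m=2^k$ with $k\ge 0$, and identify $[m]$ with the bit strings of length $k$. Fix $w\in[m]$, a noise rate $p\in(0,1]$ and $\epsilon\in\mathbb{R}$. For $f:[n]\to[m]$ the noiseless oracle is the unitary $O_f|x,y\rangle=|x,y\oplus f(x)\rangle$ on the query register $\mathsf Q=\mathbb{C}^{[n]}\otimes\mathbb{C}^{[m]}$. The noise $\mathcal N_1$ is either the completely depolarizing channel $\rho\mapsto \mathrm{tr}(\rho)\,I/(nm)$ on $\mathsf Q$, or the completely dephasing channel $\rho\mapsto\sum_{x\in[n]}(|x\rangle\langle x|\otimes I)\rho(|x\rangle\langle x|\otimes I)$ on the query input. A noisy oracle call applies $O_f$ and then $$\rho\mapsto(1-p)\rho+p\,\mathcal N_1(\rho)\quad\text{(error-concealing)}$$ or $$\rho\mapsto(1-p)\rho\otimes|0\rangle\langle 0|+p\,\mathcal N_1(\rho)\otimes|1\rangle\langle 1|\quad\text{(error-signaling)},$$ where in the second case the new flag qubit is added to the workspace of the algorithm. A query algorithm making $\tau$ queries has a workspace of any finite number of qubits, starts in a pure state of query register and workspace, alternates $\tau$ noisy oracle calls (acting as the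 identity on the workspace) with unitaries $U_1,\dots,U_\tau$ on the whole memory ($U_t$ applied after the $t$-th call), and finally performs a projective measurement $\{\Pi_x\}_{x\in[n]}$, returning the outcome $x$; state, unitaries and measurement do not depend on $f$. Its success probability is the probability that $f(x)=w$ when $f:[n]\to[m]$ is uniformly random. Theorem. For both the depolarizing and the dephasing noise of rate $p$, every query algorithm with error-concealing noisy oracle calls whose success probability is at least $1-\epsilon$ makes at least $$\frac{mp(1-\epsilon)}{32}-1$$ queries. The same lower bound holds for every query algorithm with error-signaling noisy oracle calls. -/

import Mathlib

open scoped Matrix Kronecker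

noncomputable section

namespace NoisySearch

/-- Bit strings of length `k`; they represent the `m = 2 ^ k` elements of `[m]`. -/
abbrev Bits (k : ℕ) : Type := Fin k → Bool

/-- Entry-wise exclusive OR of bit strings. -/
def bitXor {k : ℕ} (y z : Bits k) : Bits k := fun i => xor (y i) (z i)

/-- Basis labels of the query register: an index in `[n]` (query input) and a bit string
(query output). -/
abbrev Query (n k : ℕ) : Type := Fin n × Bits k

/-- Basis labels of the memory: the query register and a workspace of `l` qubits. -/
abbrev Mem (n k l : ℕ) : Type := Query n k × (Fin l → Bool)

/-- Linear operators on the space with standard basis labelled by `ι`. -/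
abbrev Op (ι : Type) : Type := Matrix ι ι ℂ

/-- The map `ρ ↦ V ρ Vᴴ`. -/
def conjBy {ι κ : Type} [Fintype ι] (V : Matrix κ ι ℂ) : Op ι →ₗ[ℂ] Op κ where
  toFun ρ := V * ρ * Vᴴ
  map_add' ρ σ := by rw [Matrix.mul_add, Matrix.add_mul]
  map_smul' c ρ := by rw [Matrix.mul_smul, Matrix.smul_mul, RingHom.id_apply]

/-- The noiseless oracle `|x, y⟩ ↦ |x, y ⊕ f(x)⟩`. -/
def oracleMatrix {n k : ℕ} (f : Fin n → Bits k) : Op (Query n k) :=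
  Matrix.of fun a b => if a = (b.1, bitXor b.2 (f b.1)) then 1 else 0

/-- The channel of the noiseless oracle. -/
def oracleChannel {n k : ℕ} (f : Fin n → Bits k) : Op (Query n k) →ₗ[ℂ] Op (Query n k) :=
  conjBy (oracleMatrix f)

/-- The two noise models. -/
inductive Noise : Type
  | depolarizing
  | dephasing

/-- The completely depolarizing channel `ρ ↦ tr(ρ) I / (n m)` of the whole query register. -/
def completeDepolarizing (n k : ℕ) : Op (Query n k) →ₗ[ℂ] Op (Query n k) :=
  (Matrix.traceLinearMap (Query n k) ℂ ℂ).smulRight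
    (((n : ℂ) * 2 ^ k)⁻¹ • (1 : Op (Query n k)))

/-- The completely dephasing channel `ρ ↦ ∑ x, (|x⟩⟨x| ⊗ I) ρ (|x⟩⟨x| ⊗ I)` of the query input. -/
def completeDephasing (n k : ℕ) : Op (Query n k) →ₗ[ℂ] Op (Query n k) :=
  ∑ x : Fin n, conjBy (Matrix.single x x (1 : ℂ) ⊗ₖ (1 : Op (Bits k)))

/-- The noise of rate one. -/
def completeNoise (n k : ℕ) : Noise → (Op (Query n k) →ₗ[ℂ] Op (Query n k))
  | .depolarizing => completeDepolarizing n k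
  | .dephasing => completeDephasing n k

/-- The map `ρ ↦ ρ ⊗ |b⟩⟨b|` that appends a qubit in the basis state `b`. -/
def appendFlag {ι : Type} (b : Bool) : Op ι →ₗ[ℂ] Op (ι × Bool) where
  toFun ρ := ρ ⊗ₖ Matrix.single b b (1 : ℂ)
  map_add' ρ σ := Matrix.add_kronecker ρ σ _
  map_smul' c ρ := Matrix.smul_kronecker c ρ _

/-- Noise of rate `p`: with probability `p` the complete noise is applied. -/
def noise (n k : ℕ) (N : Noise) (p : ℝ) : Op (Query n k) →ₗ[ℂ] Op (Query n k) :=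
  ((1 - p : ℝ) : ℂ) • LinearMap.id + (p : ℂ) • completeNoise n k N

/-- Error-signaling noise of rate `p`: the appended qubit tells whether (`true`) or not (`false`)
the error has occurred. -/
def signalingNoise (n k : ℕ) (N : Noise) (p : ℝ) :
    Op (Query n k) →ₗ[ℂ] Op (Query n k × Bool) :=
  ((1 - p : ℝ) : ℂ) • appendFlag false + (p : ℂ) • (appendFlag true ∘ₗ completeNoise n k N)

/-- The error-concealing noisy oracle call. -/
def noisyOracle {n k : ℕ} (N : Noise) (p : ℝ) (f : Fin n → Bits k) :
    Op (Query n k) →ₗ[ℂ] Op (Query n k) :=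
  noise n k N p ∘ₗ oracleChannel f

/-- The error-signaling noisy oracle call. -/
def signalingOracle {n k : ℕ} (N : Noise) (p : ℝ) (f : Fin n → Bits k) :
    Op (Query n k) →ₗ[ℂ] Op (Query n k × Bool) :=
  signalingNoise n k N p ∘ₗ oracleChannel f

/-- The action of `Φ ⊗ id` on an operator on a register with a further register labelled by `W`:
`Φ` is applied to each block. -/
def tensorId {ι κ W : Type} (Φ : Op ι →ₗ[ℂ] Op κ) (ρ : Op (ι × W)) : Op (κ × W) :=
  Matrix.of fun a b => Φ (Matrix.of fun i j => ρ (i, a.2) (j, b.2)) a.1 b.1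

/-- The new flag qubit is incorporated into the workspace as its last qubit. -/
def flagToWorkspace {ι : Type} {l : ℕ} (ρ : Op ((ι × Bool) × (Fin l → Bool))) :
    Op (ι × (Fin (l + 1) → Bool)) :=
  ρ.submatrix (fun a => ((a.1, a.2 (Fin.last l)), Fin.init a.2))
    (fun a => ((a.1, a.2 (Fin.last l)), Fin.init a.2))

/-- The density operator `|ψ⟩⟨ψ|`. -/
def pureState {ι : Type} (ψ : EuclideanSpace ℂ ι) : Op ι :=
  Matrix.of fun i j => ψ i * star (ψ j)

/-- A projective measurement with outcomes in `α`: orthogonal projectors that sum to `I`. -/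
structure Measurement (α ι : Type) [Fintype α] [Fintype ι] [DecidableEq ι] where
  proj : α → Op ι
  isProj : ∀ a, IsStarProjection (proj a)
  complete : ∑ a, proj a = 1

/-- The probability that the outcome of the measurement of `ρ` satisfies `P`. -/
def Measurement.prob {α ι : Type} [Fintype α] [Fintype ι] [DecidableEq ι]
    (M : Measurement α ι) (ρ : Op ι) (P : α → Prop) [DecidablePred P] : ℝ :=
  ∑ a with P a, ((M.proj a * ρ).trace).re

/-- A search algorithm that uses error-concealing noisy oracle calls: the number of queries, the
initial number of workspace qubits, the initial pure state, the unitaries applied after each query,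
and the final measurement. -/
structure ConcealingAlgorithm (n k : ℕ) where
  queries : ℕ
  qubits : ℕ
  init : EuclideanSpace ℂ (Mem n k qubits)
  norm_init : ‖init‖ = 1
  unitary : Fin queries → Matrix.unitaryGroup (Mem n k qubits) ℂ
  measurement : Measurement (Fin n) (Mem n k qubits)

/-- The state after `t` queries and the unitary following each of them. -/
def ConcealingAlgorithm.state {n k : ℕ} (A : ConcealingAlgorithm n k) (N : Noise) (p : ℝ)
    (f : Fin n → Bits k) : (t : ℕ) → t ≤ A.queries → Op (Mem n k A.qubits)
  | 0, _ => pureState A.init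
  | t + 1, h => conjBy (A.unitary ⟨t, h⟩ : Op (Mem n k A.qubits))
      (tensorId (noisyOracle N p f) (A.state N p f t (Nat.le_of_succ_le h)))

/-- The probability, over a uniformly random `f` and the measurement outcome `x`, that
`f x = w`. -/
def ConcealingAlgorithm.successProb {n k : ℕ} (A : ConcealingAlgorithm n k) (N : Noise) (p : ℝ)
    (w : Bits k) : ℝ :=
  (∑ f : Fin n → Bits k,
    A.measurement.prob (A.state N p f A.queries le_rfl) (fun x => f x = w)) / (2 ^ k) ^ n

/-- A search algorithm that uses error-signaling noisy oracle calls. Each query extends the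
workspace by the flag qubit, so that after the `t`-th query (counted from one) the algorithm acts
on a workspace of `qubits + t` qubits. -/
structure SignalingAlgorithm (n k : ℕ) where
  queries : ℕ
  qubits : ℕ
  init : EuclideanSpace ℂ (Mem n k qubits)
  norm_init : ‖init‖ = 1
  unitary : (t : Fin queries) → Matrix.unitaryGroup (Mem n k (qubits + (t.1 + 1))) ℂ
  measurement : Measurement (Fin n) (Mem n k (qubits + queries))

/-- The state after `t` queries and the unitary following each of them. -/
def SignalingAlgorithm.state {n k : ℕ} (A : SignalingAlgorithm n k) (N : Noise) (p : ℝ)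
    (f : Fin n → Bits k) : (t : ℕ) → t ≤ A.queries → Op (Mem n k (A.qubits + t))
  | 0, _ => pureState A.init
  | t + 1, h => conjBy (A.unitary ⟨t, h⟩ : Op (Mem n k (A.qubits + (t + 1))))
      (flagToWorkspace
        (tensorId (signalingOracle N p f) (A.state N p f t (Nat.le_of_succ_le h))))

/-- The probability, over a uniformly random `f` and the measurement outcome `x`, that
`f x = w`. -/
def SignalingAlgorithm.successProb {n k : ℕ} (A : SignalingAlgorithm n k) (N : Noise) (p : ℝ)
    (w : Bits k) : ℝ :=
  (∑ f : Fin n → Bits k,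
    A.measurement.prob (A.state N p f A.queries le_rfl) (fun x => f x = w)) / (2 ^ k) ^ n

end NoisySearch

end

/-!
The bound is proved by the hybrid method, applied separately to every error trajectory. Let
`m = 2 ^ k`. Both noises of rate one have Kraus operators each of which reveals the query input
(`exists_kraus_completeNoise`), so the state for the function `f` is a mixture of pure states
`ψ f`, one for each trajectory, and a trajectory comes with the set `K` of the inputs that its
errors have revealed (`HasUnraveling`). All functions with a preimage of `w` in `K` are conceded to
the algorithm: their squared norm is `deadMass`. For the other functions, `hybridGap` sums
`‖ψ f - ψ f'‖²` over the inputs `x ∉ K`, where `f'` is `f` with its value at `x` overwritten by `w`.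
The potential of the trajectory is `deadMass + (4 / m) * hybridGap`.

A query changes the difference `ψ f - ψ f'` only in its part with query input `x`, by at most twice
the norm of that part of `ψ f`. If an error occurs, then `x` enters `K` and the queried part of the
gap (`queriedGap`) leaves `hybridGap`; in return, the functions with `f x = w` become dead. Since a
random function conditioned on `f x = w` is a random function overwritten at `x`
(`sum_filter_update`), their squared norm is at most `2 / m` times the queried gap plus `2 / m`
times the squared norm that is queried. Hence an error, which has probability `p`, pays for the
interference between the old gap and its growth, and the weighted inequality
`‖a + b‖² ≤ (1 + p / 2) ‖a‖² + (1 + 2 / p) ‖b‖²` shows that the potential grows by at most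
`32 / (p m)` per query (`potential_query_le`). By resampling once more, the final measurement
succeeds with probability at most the potential plus `2 / m` (`sum_mass_proj_le_potential`).

The error-concealing and the error-signaling oracle differ only in an isometry that is applied
after the query, which may depend on whether the error has occurred (`HasUnraveling.query`).
-/

open scoped Matrix Kronecker

noncomputable section

namespace NoisySearch

/-! ### Squared norms -/

/-- The squared Euclidean norm of a vector of amplitudes. -/
def mass {ι : Type} [Fintype ι] (v : ι → ℂ) : ℝ := ∑ i, ‖v i‖ ^ 2

/-- The squared norm of the part of the vector whose query input is `x`. -/
def massAt {n k : ℕ} {W : Type} [Fintype W] (x : Fin n) (v : Query n k × W → ℂ) : ℝ :=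
  ∑ i, if i.1.1 = x then ‖v i‖ ^ 2 else 0

lemma mass_nonneg {ι : Type} [Fintype ι] (v : ι → ℂ) : 0 ≤ mass v :=
  Finset.sum_nonneg fun _ _ => sq_nonneg _

lemma massAt_nonneg {n k : ℕ} {W : Type} [Fintype W] (x : Fin n) (v : Query n k × W → ℂ) :
    0 ≤ massAt x v :=
  Finset.sum_nonneg fun _ _ => by split_ifs <;> positivity

lemma sum_massAt {n k : ℕ} {W : Type} [Fintype W] (v : Query n k × W → ℂ) :
    ∑ x, massAt x v = mass v := by
  simp only [massAt, mass]
  rw [Finset.sum_comm]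
  simp

lemma norm_add_sq_le_weighted (a b : ℂ) {s : ℝ} (hs : 0 < s) :
    ‖a + b‖ ^ 2 ≤ (1 + s) * ‖a‖ ^ 2 + (1 + 1 / s) * ‖b‖ ^ 2 := by
  have h : ‖a + b‖ ^ 2 ≤ (‖a‖ + ‖b‖) ^ 2 := by gcongr; exact norm_add_le a b
  have h2 : (1 + s) * ‖a‖ ^ 2 + (1 + 1 / s) * ‖b‖ ^ 2 - (‖a‖ + ‖b‖) ^ 2
      = (s * ‖a‖ - ‖b‖) ^ 2 / s := by
    field_simp
    ring
  have h3 : 0 ≤ (s * ‖a‖ - ‖b‖) ^ 2 / s := by positivity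
  linarith

lemma norm_sq_le_two_mul_sub (a b : ℂ) : ‖b‖ ^ 2 ≤ 2 * ‖a - b‖ ^ 2 + 2 * ‖a‖ ^ 2 := by
  have h := norm_add_sq_le_weighted (b - a) a one_pos
  rw [sub_add_cancel, norm_sub_rev b a] at h
  linarith

lemma mass_le_two_mul_sub {ι : Type} [Fintype ι] (u v : ι → ℂ) :
    mass v ≤ 2 * mass (u - v) + 2 * mass u := by
  simp only [mass, Finset.mul_sum, ← Finset.sum_add_distrib]
  exact Finset.sum_le_sum fun i _ => norm_sq_le_two_mul_sub _ _

lemma massAt_le_two_mul_sub {n k : ℕ} {W : Type} [Fintype W] (x : Fin n)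
    (u v : Query n k × W → ℂ) : massAt x v ≤ 2 * massAt x (u - v) + 2 * massAt x u := by
  simp only [massAt, Finset.mul_sum, ← Finset.sum_add_distrib]
  refine Finset.sum_le_sum fun i _ => ?_
  split_ifs
  · exact norm_sq_le_two_mul_sub _ _
  · simp

lemma massAt_add_le_weighted {n k : ℕ} {W : Type} [Fintype W] (x : Fin n)
    (u v : Query n k × W → ℂ) {s : ℝ} (hs : 0 < s) :
    massAt x (u + v) ≤ (1 + s) * massAt x u + (1 + 1 / s) * massAt x v := by
  simp only [massAt, Finset.mul_sum, ← Finset.sum_add_distrib]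
  refine Finset.sum_le_sum fun i _ => ?_
  split_ifs
  · exact norm_add_sq_le_weighted _ _ hs
  · simp

lemma mass_eq_dotProduct {ι : Type} [Fintype ι] (v : ι → ℂ) :
    mass v = (star v ⬝ᵥ v).re := by
  simp only [mass, dotProduct, Complex.re_sum, Pi.star_apply]
  refine Finset.sum_congr rfl fun i _ => ?_
  rw [← Complex.normSq_eq_norm_sq, RCLike.star_def, mul_comm, Complex.mul_conj, Complex.ofReal_re]

/-- The squared norm of `A v` depends on the Gram matrix `Aᴴ A` only. -/
lemma mass_mulVec {ι κ : Type} [Fintype ι] [Fintype κ] (A : Matrix κ ι ℂ) (v : ι → ℂ) :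
    mass (A *ᵥ v) = (star v ⬝ᵥ ((Aᴴ * A) *ᵥ v)).re := by
  rw [mass_eq_dotProduct, Matrix.star_mulVec, ← Matrix.dotProduct_mulVec, Matrix.mulVec_mulVec]

/-! ### One query on a vector -/

/-- The noiseless oracle, acting as the identity on the workspace. -/
def queryVec {n k : ℕ} {W : Type} (f : Fin n → Bits k) (v : Query n k × W → ℂ) :
    Query n k × W → ℂ :=
  fun i => v ((i.1.1, bitXor i.1.2 (f i.1.1)), i.2)

lemma bitXor_bitXor {k : ℕ} (y z : Bits k) : bitXor (bitXor y z) z = y := by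
  funext i
  simp [bitXor]

lemma oracleMatrix_mulVec {n k : ℕ} {W : Type} [Fintype W] [DecidableEq W]
    (f : Fin n → Bits k) (v : Query n k × W → ℂ) :
    (oracleMatrix f ⊗ₖ (1 : Matrix W W ℂ)) *ᵥ v = queryVec f v := by
  funext i
  obtain ⟨a, c⟩ := i
  have h : ∀ b : Query n k, a = (b.1, bitXor b.2 (f b.1)) ↔ b = (a.1, bitXor a.2 (f a.1)) := by
    rintro ⟨x, y⟩
    constructor
    · rintro rfl
      simp [bitXor_bitXor]
    · intro h
      obtain ⟨rfl, rfl⟩ := Prod.mk.inj h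
      simp [bitXor_bitXor]
  simp only [Matrix.mulVec, dotProduct, Fintype.sum_prod_type (α₁ := Query n k),
    Matrix.kroneckerMap_apply, oracleMatrix, Matrix.of_apply, Matrix.one_apply, queryVec]
  simp only [h, ite_mul, one_mul, zero_mul, mul_ite, mul_one, mul_zero]
  simp only [Finset.sum_ite_eq, Finset.mem_univ, if_true]
  rw [Finset.sum_eq_single (a.1, bitXor a.2 (f a.1))]
  · simp
  · intro b _ hb
    simp [hb]
  · simp

lemma massAt_queryVec {n k : ℕ} {W : Type} [Fintype W] (x : Fin n) (f : Fin n → Bits k)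
    (v : Query n k × W → ℂ) : massAt x (queryVec f v) = massAt x v := by
  let g : Query n k × W → Query n k × W := fun i => ((i.1.1, bitXor i.1.2 (f i.1.1)), i.2)
  have hg : Function.Involutive g := fun i => by simp [g, bitXor_bitXor]
  exact Equiv.sum_comp (hg.toPerm g) fun i => if i.1.1 = x then ‖v i‖ ^ 2 else 0

lemma mass_queryVec {n k : ℕ} {W : Type} [Fintype W] (f : Fin n → Bits k)
    (v : Query n k × W → ℂ) : mass (queryVec f v) = mass v := by
  simp only [← sum_massAt, massAt_queryVec]

lemma queryVec_sub {n k : ℕ} {W : Type} (f : Fin n → Bits k) (u v : Query n k × W → ℂ) :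
    queryVec f (u - v) = queryVec f u - queryVec f v := rfl

/-- Queries to two functions that agree at `z` treat the part with query input `z` alike. -/
lemma massAt_queryVec_sub_of_eq {n k : ℕ} {W : Type} [Fintype W] {z : Fin n}
    {f g : Fin n → Bits k} (h : f z = g z) (u v : Query n k × W → ℂ) :
    massAt z (queryVec f u - queryVec g v) = massAt z (u - v) := by
  rw [← massAt_queryVec z f (u - v)]
  refine Finset.sum_congr rfl fun i _ => ?_
  split_ifs with hi
  · simp only [queryVec, Pi.sub_apply, hi, h]
  · rfl

/-- At the input where the two functions differ, one query increases the distance of the two states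
by at most twice the norm of the queried part; the square is expanded with weight `s`. -/
lemma massAt_queryVec_sub_le {n k : ℕ} {W : Type} [Fintype W] (x : Fin n)
    (f g : Fin n → Bits k) (u v : Query n k × W → ℂ) {s : ℝ} (hs : 0 < s) :
    massAt x (queryVec f u - queryVec g v)
      ≤ (1 + s) * massAt x (u - v) + (1 + 1 / s) * (4 * massAt x u) := by
  have h : queryVec f u - queryVec g v = queryVec g (u - v) + (queryVec f u - queryVec g u) := by
    rw [queryVec_sub]
    abel
  have h2 : massAt x (queryVec f u - queryVec g u) ≤ 4 * massAt x u := by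
    have := massAt_le_two_mul_sub x (queryVec g u) (queryVec g u - queryVec f u)
    rw [sub_sub_cancel, massAt_queryVec, massAt_queryVec] at this
    have h3 : massAt x (queryVec f u - queryVec g u) = massAt x (queryVec g u - queryVec f u) := by
      simp only [massAt, Pi.sub_apply]
      exact Finset.sum_congr rfl fun i _ => by rw [norm_sub_rev]
    linarith
  rw [h]
  refine (massAt_add_le_weighted x _ _ hs).trans ?_
  rw [massAt_queryVec]
  gcongr

/-! ### Resampling one value of a random function -/

/-- Conditioning a random function on `f x = w` is the same as overwriting its value at `x` by `w`,
also under a condition on the values at inputs other than `x`. -/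
lemma sum_filter_update {n k : ℕ} (w : Bits k) {K : Finset (Fin n)} {x : Fin n} (hx : x ∉ K)
    (G : (Fin n → Bits k) → ℝ) :
    ∑ f with (∀ y ∈ K, f y ≠ w), G (Function.update f x w)
      = 2 ^ k * ∑ f with (∀ y ∈ K, f y ≠ w) ∧ f x = w, G f := by
  have halive : ∀ (f : Fin n → Bits k) (b : Bits k),
      (∀ y ∈ K, Function.update f x b y ≠ w) ↔ ∀ y ∈ K, f y ≠ w := by
    intro f b
    refine forall₂_congr fun y hy => ?_
    rw [Function.update_of_ne (by rintro rfl; exact hx hy)]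
  rw [← Finset.sum_fiberwise_of_maps_to (s := Finset.univ.filter fun f => ∀ y ∈ K, f y ≠ w)
    (t := Finset.univ.filter fun f => (∀ y ∈ K, f y ≠ w) ∧ f x = w)
    (g := fun f => Function.update f x w), Finset.mul_sum]
  · refine Finset.sum_congr rfl fun g hg => ?_
    obtain ⟨hgK, hgx⟩ := (Finset.mem_filter.1 hg).2
    rw [Finset.sum_congr rfl (g := fun _ => G g)
      (fun f hf => by rw [(Finset.mem_filter.1 hf).2]), Finset.sum_const, nsmul_eq_mul]
    congr 1
    -- The functions that become `g` are obtained from `g` by an arbitrary value at `x`.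
    have : (Finset.univ.filter fun f : Fin n → Bits k => ∀ y ∈ K, f y ≠ w).filter
        (fun f => Function.update f x w = g)
        = Finset.univ.image fun b : Bits k => Function.update g x b := by
      ext f
      simp only [Finset.mem_filter, Finset.mem_univ, true_and, Finset.mem_image]
      constructor
      · rintro ⟨_, rfl⟩
        exact ⟨f x, by simp⟩
      · rintro ⟨b, rfl⟩
        refine ⟨(halive g b).2 hgK, ?_⟩
        rw [Function.update_idem, ← hgx, Function.update_eq_self]
    rw [this, Finset.card_image_of_injective _ (Function.update_injective g x), Finset.card_univ]
    simp
  · intro f hf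
    simp only [Finset.mem_filter, Finset.mem_univ, true_and] at hf ⊢
    exact ⟨(halive f w).2 hf, by simp⟩

/-! ### The potential of a trajectory -/

/-- The total squared norm over the functions that map a revealed input to `w`. The finset `K`
holds the inputs revealed by errors. -/
def deadMass {n k : ℕ} {ι : Type} [Fintype ι] (w : Bits k) (K : Finset (Fin n))
    (ψ : (Fin n → Bits k) → ι → ℂ) : ℝ :=
  ∑ f with ¬ ∀ y ∈ K, f y ≠ w, mass (ψ f)

/-- How much the state reacts to overwriting one value of the function by `w` at an input that has
not been revealed, over the functions that map no revealed input to `w`. -/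
def hybridGap {n k : ℕ} {ι : Type} [Fintype ι] (w : Bits k) (K : Finset (Fin n))
    (ψ : (Fin n → Bits k) → ι → ℂ) : ℝ :=
  ∑ x with x ∉ K, ∑ f with ∀ y ∈ K, f y ≠ w, mass (ψ f - ψ (Function.update f x w))

/-- The part of `hybridGap` in which the overwritten input is the queried one. -/
def queriedGap {n k : ℕ} {W : Type} [Fintype W] (w : Bits k) (K : Finset (Fin n))
    (ψ : (Fin n → Bits k) → Query n k × W → ℂ) : ℝ :=
  ∑ x with x ∉ K, ∑ f with ∀ y ∈ K, f y ≠ w, massAt x (ψ f - ψ (Function.update f x w))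

/-- The progress measure of a trajectory with revealed inputs `K`. -/
def potential {n k : ℕ} {ι : Type} [Fintype ι] (w : Bits k) (K : Finset (Fin n))
    (ψ : (Fin n → Bits k) → ι → ℂ) : ℝ :=
  deadMass w K ψ + 4 / 2 ^ k * hybridGap w K ψ

lemma hybridGap_nonneg {n k : ℕ} {ι : Type} [Fintype ι] (w : Bits k) (K : Finset (Fin n))
    (ψ : (Fin n → Bits k) → ι → ℂ) : 0 ≤ hybridGap w K ψ :=
  Finset.sum_nonneg fun _ _ => Finset.sum_nonneg fun _ _ => mass_nonneg _

lemma queriedGap_nonneg {n k : ℕ} {W : Type} [Fintype W] (w : Bits k) (K : Finset (Fin n))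
    (ψ : (Fin n → Bits k) → Query n k × W → ℂ) : 0 ≤ queriedGap w K ψ :=
  Finset.sum_nonneg fun _ _ => Finset.sum_nonneg fun _ _ => massAt_nonneg _ _

lemma sum_massAt_le_sum_mass {n k : ℕ} {W : Type} [Fintype W] (w : Bits k) (K : Finset (Fin n))
    (ψ : (Fin n → Bits k) → Query n k × W → ℂ) :
    ∑ x with x ∉ K, ∑ f with ∀ y ∈ K, f y ≠ w, massAt x (ψ f) ≤ ∑ f, mass (ψ f) := by
  rw [Finset.sum_comm]
  calc ∑ f with ∀ y ∈ K, f y ≠ w, ∑ x with x ∉ K, massAt x (ψ f)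
      ≤ ∑ f with ∀ y ∈ K, f y ≠ w, mass (ψ f) := by
        refine Finset.sum_le_sum fun f _ => ?_
        rw [← sum_massAt]
        exact Finset.sum_le_sum_of_subset_of_nonneg (Finset.filter_subset _ _)
          fun _ _ _ => massAt_nonneg _ _
    _ ≤ _ := Finset.sum_le_sum_of_subset_of_nonneg (Finset.filter_subset _ _)
          fun _ _ _ => mass_nonneg _

/-! ### The effect of a noisy query on the potential -/

/-- Away from the overwritten input, a query preserves the distance of the two states. -/
lemma sum_massAt_queryVec_update {n k : ℕ} {W : Type} [Fintype W] (x : Fin n) (w : Bits k)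
    (f : Fin n → Bits k) (u v : Query n k × W → ℂ) :
    ∑ z with z ≠ x, massAt z (queryVec f u - queryVec (Function.update f x w) v)
      = mass (u - v) - massAt x (u - v) := by
  have h : ∑ z with z ≠ x, massAt z (queryVec f u - queryVec (Function.update f x w) v)
      = ∑ z with z ≠ x, massAt z (u - v) :=
    Finset.sum_congr rfl fun z hz =>
      massAt_queryVec_sub_of_eq (by rw [Function.update_of_ne (Finset.mem_filter.1 hz).2]) u v
  rw [h, ← sum_massAt, Finset.filter_ne', Finset.sum_erase_eq_sub (Finset.mem_univ x)]

/-- Without an error, the hybrid gap grows because of its queried part only. -/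
lemma hybridGap_queryVec_le {n k : ℕ} {W : Type} [Fintype W] (w : Bits k)
    (K : Finset (Fin n)) (ψ : (Fin n → Bits k) → Query n k × W → ℂ) {s : ℝ} (hs : 0 < s) :
    hybridGap w K (fun f => queryVec f (ψ f)) ≤ hybridGap w K ψ - queriedGap w K ψ
      + ((1 + s) * queriedGap w K ψ + (1 + 1 / s) * (4 * ∑ f, mass (ψ f))) := by
  have hT := sum_massAt_le_sum_mass w K ψ
  have h : hybridGap w K (fun f => queryVec f (ψ f)) ≤ hybridGap w K ψ - queriedGap w K ψ
      + ((1 + s) * queriedGap w K ψ + (1 + 1 / s) *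
        (4 * ∑ x with x ∉ K, ∑ f with ∀ y ∈ K, f y ≠ w, massAt x (ψ f))) := by
    simp only [hybridGap, queriedGap, Finset.mul_sum, ← Finset.sum_add_distrib,
      ← Finset.sum_sub_distrib]
    refine Finset.sum_le_sum fun x _ => Finset.sum_le_sum fun f _ => ?_
    have h1 := sum_massAt_queryVec_update x w f (ψ f) (ψ (Function.update f x w))
    rw [Finset.filter_ne', Finset.sum_erase_eq_sub (Finset.mem_univ x), sum_massAt] at h1
    have h2 := massAt_queryVec_sub_le x f (Function.update f x w) (ψ f)
      (ψ (Function.update f x w)) hs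
    linarith
  refine h.trans ?_
  gcongr

/-- When an error reveals the query input, the queried part of the hybrid gap disappears. -/
lemma sum_hybridGap_insert_le {n k : ℕ} {W : Type} [Fintype W] (w : Bits k)
    (K : Finset (Fin n)) (ψ : (Fin n → Bits k) → Query n k × W → ℂ) :
    ∑ z, ∑ x with x ∉ insert z K, ∑ f with ∀ y ∈ insert z K, f y ≠ w,
      massAt z (queryVec f (ψ f) - queryVec (Function.update f x w) (ψ (Function.update f x w)))
      ≤ hybridGap w K ψ - queriedGap w K ψ := by
  have h : hybridGap w K ψ - queriedGap w K ψ
      = ∑ x with x ∉ K, ∑ f with ∀ y ∈ K, f y ≠ w, ∑ z with z ≠ x,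
        massAt z (queryVec f (ψ f)
          - queryVec (Function.update f x w) (ψ (Function.update f x w))) := by
    simp only [hybridGap, queriedGap, ← Finset.sum_sub_distrib, sum_massAt_queryVec_update]
  calc _ ≤ ∑ z, ∑ x with x ∉ K ∧ z ≠ x, ∑ f with ∀ y ∈ K, f y ≠ w,
        massAt z (queryVec f (ψ f)
          - queryVec (Function.update f x w) (ψ (Function.update f x w))) := by
        refine Finset.sum_le_sum fun z _ => ?_
        refine (Finset.sum_le_sum fun x _ => Finset.sum_le_sum_of_subset_of_nonneg
          (t := Finset.univ.filter fun f : Fin n → Bits k => ∀ y ∈ K, f y ≠ w) ?_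
          fun _ _ _ => massAt_nonneg _ _).trans
          (Finset.sum_le_sum_of_subset_of_nonneg ?_
            fun _ _ _ => Finset.sum_nonneg fun _ _ => massAt_nonneg _ _)
        · exact Finset.monotone_filter_right _ fun f _ hf y hy =>
            hf y (Finset.mem_insert_of_mem hy)
        · refine Finset.monotone_filter_right _ fun x _ hx => ?_
          rw [Finset.mem_insert, not_or] at hx
          exact ⟨hx.2, fun h => hx.1 h.symm⟩
    _ = hybridGap w K ψ - queriedGap w K ψ := by
        rw [h, Finset.sum_comm' (t' := Finset.univ.filter fun x => x ∉ K)
          (s' := fun x => Finset.univ.filter fun z => z ≠ x) (by simp [and_comm])]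
        exact Finset.sum_congr rfl fun x _ => Finset.sum_comm

/-- When an error reveals the query input `x`, the functions with `f x = w` are lost; by
resampling, their squared norm is that of the states for overwritten functions, which differ from
the original states by the queried gap. -/
lemma sum_massAt_dead_insert_le {n k : ℕ} {W : Type} [Fintype W] (w : Bits k)
    (K : Finset (Fin n)) (ψ : (Fin n → Bits k) → Query n k × W → ℂ) :
    ∑ x, ∑ f with ¬ ∀ y ∈ insert x K, f y ≠ w, massAt x (ψ f)
      ≤ deadMass w K ψ + 2 / 2 ^ k * (queriedGap w K ψ + ∑ f, mass (ψ f)) := by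
  have h1 : ∑ x, ∑ f with ¬ ∀ y ∈ insert x K, f y ≠ w, massAt x (ψ f)
      = deadMass w K ψ
        + ∑ x with x ∉ K, ∑ f with (∀ y ∈ K, f y ≠ w) ∧ f x = w, massAt x (ψ f) := by
    have h2 : deadMass w K ψ = ∑ x, ∑ f with ¬ ∀ y ∈ K, f y ≠ w, massAt x (ψ f) := by
      rw [Finset.sum_comm]
      simp only [sum_massAt, deadMass]
    rw [h2, Finset.sum_filter, ← Finset.sum_add_distrib]
    refine Finset.sum_congr rfl fun x _ => ?_
    by_cases hx : x ∈ K
    · simp [hx]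
    · rw [if_pos hx]
      simp only [Finset.sum_filter, ← Finset.sum_add_distrib, Finset.forall_mem_insert]
      refine Finset.sum_congr rfl fun f _ => ?_
      split_ifs <;> first | (exfalso; tauto) | simp
  have h5 : ∀ x ∈ Finset.univ.filter (fun x => x ∉ K),
      ∑ f with (∀ y ∈ K, f y ≠ w) ∧ f x = w, massAt x (ψ f)
        ≤ 2 / 2 ^ k * (∑ f with ∀ y ∈ K, f y ≠ w, massAt x (ψ f - ψ (Function.update f x w))
          + ∑ f with ∀ y ∈ K, f y ≠ w, massAt x (ψ f)) := by
    intro x hx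
    have h6 := sum_filter_update w (Finset.mem_filter.1 hx).2 fun f => massAt x (ψ f)
    have h7 : ∑ f with ∀ y ∈ K, f y ≠ w, massAt x (ψ (Function.update f x w))
        ≤ 2 * (∑ f with ∀ y ∈ K, f y ≠ w, massAt x (ψ f - ψ (Function.update f x w))
          + ∑ f with ∀ y ∈ K, f y ≠ w, massAt x (ψ f)) := by
      rw [← Finset.sum_add_distrib, Finset.mul_sum]
      refine Finset.sum_le_sum fun f _ => ?_
      rw [mul_add]
      exact massAt_le_two_mul_sub _ _ _
    rw [h6] at h7
    rw [div_mul_eq_mul_div, le_div_iff₀ (by positivity), mul_comm]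
    exact h7
  rw [h1]
  gcongr
  refine (Finset.sum_le_sum h5).trans ?_
  rw [← Finset.mul_sum, Finset.sum_add_distrib]
  gcongr
  · exact le_rfl
  · exact sum_massAt_le_sum_mass w K ψ

/-- Operators that reveal the query input, applied to a family of vectors that may depend on the
revealed input. -/
lemma sum_mass_mulVec_le {n k : ℕ} {W κ J β : Type} [Fintype W] [Fintype κ] [Fintype J]
    {p : ℝ} {z : J → Fin n} {A : J → Matrix κ (Query n k × W) ℂ}
    (hA : ∀ x v, ∑ j with z j = x, mass (A j *ᵥ v) ≤ p * massAt x v)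
    (S : Fin n → Finset β) (v : β → Query n k × W → ℂ) :
    ∑ j, ∑ b ∈ S (z j), mass (A j *ᵥ v b) ≤ p * ∑ x, ∑ b ∈ S x, massAt x (v b) := by
  rw [← Finset.sum_fiberwise (s := Finset.univ) (g := z), Finset.mul_sum]
  refine Finset.sum_le_sum fun x _ => ?_
  rw [Finset.sum_congr rfl (g := fun j => ∑ b ∈ S x, mass (A j *ᵥ v b))
    (fun j hj => by rw [(Finset.mem_filter.1 hj).2]), Finset.sum_comm, Finset.mul_sum]
  exact Finset.sum_le_sum fun b _ => hA x (v b)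

/-- One noisy query increases the potential, summed over the continuations of a trajectory, by at
most `32 / (p 2 ^ k)` times the squared norm. The operator `A₀` applies when no error
occurs; the operators `A j` apply when an error reveals the query input `z j`. -/
theorem potential_query_le {n k : ℕ} {W κ J : Type} [Fintype W] [Fintype κ] [Fintype J]
    {p : ℝ} (hp : 0 < p) (hp1 : p ≤ 1) {z : J → Fin n} {A₀ : Matrix κ (Query n k × W) ℂ}
    {A : J → Matrix κ (Query n k × W) ℂ}
    (hA₀ : ∀ v, mass (A₀ *ᵥ v) ≤ (1 - p) * mass v)
    (hA : ∀ x v, ∑ j with z j = x, mass (A j *ᵥ v) ≤ p * massAt x v)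
    (w : Bits k) (K : Finset (Fin n)) (ψ : (Fin n → Bits k) → Query n k × W → ℂ) :
    potential w K (fun f => A₀ *ᵥ queryVec f (ψ f))
      + ∑ j, potential w (insert (z j) K) (fun f => A j *ᵥ queryVec f (ψ f))
      ≤ potential w K ψ + 32 / (p * 2 ^ k) * ∑ f, mass (ψ f) := by
  set T := ∑ f, mass (ψ f)
  have hT : 0 ≤ T := Finset.sum_nonneg fun _ _ => mass_nonneg _
  have hG := queriedGap_nonneg w K ψ
  have hD₀ : deadMass w K (fun f => A₀ *ᵥ queryVec f (ψ f)) ≤ (1 - p) * deadMass w K ψ := by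
    rw [deadMass, deadMass, Finset.mul_sum]
    exact Finset.sum_le_sum fun f _ => (hA₀ _).trans_eq (by rw [mass_queryVec])
  have hD : ∑ j, deadMass w (insert (z j) K) (fun f => A j *ᵥ queryVec f (ψ f))
      ≤ p * (deadMass w K ψ + 2 / 2 ^ k * (queriedGap w K ψ + T)) := by
    refine (sum_mass_mulVec_le hA (fun x => Finset.univ.filter fun f : Fin n → Bits k =>
      ¬ ∀ y ∈ insert x K, f y ≠ w) fun f => queryVec f (ψ f)).trans ?_
    simp only [massAt_queryVec]
    gcongr
    exact sum_massAt_dead_insert_le w K ψ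
  -- With the weight `p / 2`, the terms with `queriedGap` have total coefficient `-2 p ^ 2 / 2 ^ k`.
  have hH₀ : hybridGap w K (fun f => A₀ *ᵥ queryVec f (ψ f))
      ≤ (1 - p) * (hybridGap w K ψ - queriedGap w K ψ
        + ((1 + p / 2) * queriedGap w K ψ + (1 + 1 / (p / 2)) * (4 * T))) := by
    have h1 : hybridGap w K (fun f => A₀ *ᵥ queryVec f (ψ f))
        ≤ (1 - p) * hybridGap w K (fun f => queryVec f (ψ f)) := by
      simp only [hybridGap, Finset.mul_sum, ← Matrix.mulVec_sub]
      exact Finset.sum_le_sum fun x _ => Finset.sum_le_sum fun f _ => hA₀ _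
    exact h1.trans (mul_le_mul_of_nonneg_left (hybridGap_queryVec_le w K ψ (by positivity))
      (by linarith))
  have hH : ∑ j, hybridGap w (insert (z j) K) (fun f => A j *ᵥ queryVec f (ψ f))
      ≤ p * (hybridGap w K ψ - queriedGap w K ψ) := by
    have h1 := sum_mass_mulVec_le hA
      (fun z => (Finset.univ.filter fun x => x ∉ insert z K) ×ˢ
        (Finset.univ.filter fun f : Fin n → Bits k => ∀ y ∈ insert z K, f y ≠ w))
      fun b => queryVec b.2 (ψ b.2)
        - queryVec (Function.update b.2 b.1 w) (ψ (Function.update b.2 b.1 w))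
    simp only [Finset.sum_product, Matrix.mulVec_sub] at h1
    refine h1.trans ?_
    gcongr
    exact sum_hybridGap_insert_le w K ψ
  simp only [potential, Finset.sum_add_distrib, ← Finset.mul_sum]
  set R := deadMass w K ψ
  set Q := hybridGap w K ψ
  set G := queriedGap w K ψ
  have hm : (0 : ℝ) < 4 / 2 ^ k := by positivity
  have key : (1 - p) * R + p * (R + 2 / 2 ^ k * (G + T))
      + 4 / 2 ^ k * ((1 - p) * (Q - G + ((1 + p / 2) * G + (1 + 1 / (p / 2)) * (4 * T)))
        + p * (Q - G))
      = R + 4 / 2 ^ k * Q + 32 / (p * 2 ^ k) * T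
        - (2 * p ^ 2 * G + (16 + 14 * p) * T) / 2 ^ k := by
    field_simp
    ring
  have hpos : 0 ≤ (2 * p ^ 2 * G + (16 + 14 * p) * T) / 2 ^ k := by positivity
  have := mul_le_mul_of_nonneg_left (add_le_add hH₀ hH) hm.le
  linarith

/-- A projective measurement of the final states finds a preimage of `w` with total weight at most
the potential plus `2 / 2 ^ k` times the squared norm. -/
theorem sum_mass_proj_le_potential {n k : ℕ} {ι : Type} [Fintype ι] {P : Fin n → Matrix ι ι ℂ}
    (hP : ∀ v, ∑ x, mass (P x *ᵥ v) = mass v) (w : Bits k) (K : Finset (Fin n))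
    (ψ : (Fin n → Bits k) → ι → ℂ) :
    ∑ f, ∑ x with f x = w, mass (P x *ᵥ ψ f)
      ≤ potential w K ψ + 2 / 2 ^ k * ∑ f, mass (ψ f) := by
  have hle : ∀ x v, mass (P x *ᵥ v) ≤ mass v := fun x v => by
    rw [← hP v]
    exact Finset.single_le_sum (f := fun x => mass (P x *ᵥ v)) (fun _ _ => mass_nonneg _)
      (Finset.mem_univ x)
  have h1 : ∑ f, ∑ x with f x = w, mass (P x *ᵥ ψ f) ≤ deadMass w K ψ
      + ∑ x with x ∉ K, ∑ f with (∀ y ∈ K, f y ≠ w) ∧ f x = w, mass (P x *ᵥ ψ f) := by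
    simp only [Finset.sum_filter, deadMass]
    simp only [← Finset.sum_filter (fun x => x ∉ K)]
    rw [Finset.sum_comm (s := Finset.univ.filter fun x => x ∉ K), ← Finset.sum_add_distrib]
    refine Finset.sum_le_sum fun f _ => ?_
    by_cases hf : ∀ y ∈ K, f y ≠ w
    · rw [if_neg (not_not.2 hf), zero_add, Finset.sum_filter]
      refine Finset.sum_le_sum fun x _ => ?_
      by_cases hx : f x = w
      · have hxK : x ∉ K := fun h => hf x h hx
        rw [if_pos hx, if_pos hxK, if_pos ⟨hf, hx⟩]
      · simp [hx]
    · rw [if_pos hf]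
      have h2 : ∑ x, (if f x = w then mass (P x *ᵥ ψ f) else 0) ≤ mass (ψ f) := by
        rw [← hP (ψ f)]
        refine Finset.sum_le_sum fun x _ => ?_
        split_ifs
        · exact le_rfl
        · exact mass_nonneg _
      refine h2.trans (le_add_of_nonneg_right (Finset.sum_nonneg fun x _ => ?_))
      split_ifs
      · exact mass_nonneg _
      · exact le_rfl
  have h3 : ∀ x ∈ Finset.univ.filter (fun x => x ∉ K),
      ∑ f with (∀ y ∈ K, f y ≠ w) ∧ f x = w, mass (P x *ᵥ ψ f)
        ≤ 2 / 2 ^ k * (∑ f with ∀ y ∈ K, f y ≠ w, mass (ψ f - ψ (Function.update f x w))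
          + ∑ f with ∀ y ∈ K, f y ≠ w, mass (P x *ᵥ ψ f)) := by
    intro x hx
    have h4 := sum_filter_update w (Finset.mem_filter.1 hx).2 fun f => mass (P x *ᵥ ψ f)
    have h5 : ∑ f with ∀ y ∈ K, f y ≠ w, mass (P x *ᵥ ψ (Function.update f x w))
        ≤ 2 * (∑ f with ∀ y ∈ K, f y ≠ w, mass (ψ f - ψ (Function.update f x w))
          + ∑ f with ∀ y ∈ K, f y ≠ w, mass (P x *ᵥ ψ f)) := by
      rw [← Finset.sum_add_distrib, Finset.mul_sum]
      refine Finset.sum_le_sum fun f _ => ?_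
      have h6 := mass_le_two_mul_sub (P x *ᵥ ψ f) (P x *ᵥ ψ (Function.update f x w))
      rw [← Matrix.mulVec_sub] at h6
      linarith [hle x (ψ f - ψ (Function.update f x w))]
    rw [h4] at h5
    rw [div_mul_eq_mul_div, le_div_iff₀ (by positivity), mul_comm]
    exact h5
  have h7 : ∑ x with x ∉ K, ∑ f with ∀ y ∈ K, f y ≠ w, mass (P x *ᵥ ψ f)
      ≤ ∑ f, mass (ψ f) := by
    rw [Finset.sum_comm]
    simp only [← hP (ψ _)]
    refine (Finset.sum_le_sum fun f _ => Finset.sum_le_sum_of_subset_of_nonneg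
      (Finset.filter_subset _ _) fun _ _ _ => mass_nonneg _).trans ?_
    exact Finset.sum_le_sum_of_subset_of_nonneg (Finset.filter_subset _ _)
      fun _ _ _ => Finset.sum_nonneg fun _ _ => mass_nonneg _
  have h8 := Finset.sum_le_sum h3
  rw [← Finset.mul_sum, Finset.sum_add_distrib] at h8
  have h9 : 2 / 2 ^ k * (hybridGap w K ψ
      + ∑ x with x ∉ K, ∑ f with ∀ y ∈ K, f y ≠ w, mass (P x *ᵥ ψ f))
      ≤ 4 / 2 ^ k * hybridGap w K ψ + 2 / 2 ^ k * ∑ f, mass (ψ f) := by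
    have h10 := hybridGap_nonneg w K ψ
    rw [mul_add]
    gcongr
    norm_num
  rw [potential, add_assoc]
  exact h1.trans (add_le_add_right (h8.trans h9) _)

/-! ### Kraus operators of the noise -/

lemma conjBy_apply {ι κ : Type} [Fintype ι] (V : Matrix κ ι ℂ) (ρ : Op ι) :
    conjBy V ρ = V * ρ * Vᴴ := rfl

lemma conjBy_comp {ι κ μ : Type} [Fintype ι] [Fintype κ] (V : Matrix μ κ ℂ) (U : Matrix κ ι ℂ)
    (ρ : Op ι) : conjBy V (conjBy U ρ) = conjBy (V * U) ρ := by
  simp only [conjBy_apply, Matrix.conjTranspose_mul, Matrix.mul_assoc]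

lemma conjBy_sqrt_smul {ι κ : Type} [Fintype ι] {c : ℝ} (hc : 0 ≤ c) (V : Matrix κ ι ℂ)
    (ρ : Op ι) : conjBy (((√c : ℝ) : ℂ) • V) ρ = (c : ℂ) • conjBy V ρ := by
  have h : ((√c : ℝ) : ℂ) * ((√c : ℝ) : ℂ) = c := by
    rw [← Complex.ofReal_mul, Real.mul_self_sqrt hc]
  simp only [conjBy_apply, Matrix.conjTranspose_smul, Matrix.smul_mul, Matrix.mul_smul, smul_smul,
    RCLike.star_def, Complex.conj_ofReal, h]

lemma conjBy_pureState {ι κ : Type} [Fintype ι] (V : Matrix κ ι ℂ) (v : ι → ℂ) :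
    conjBy V (pureState (WithLp.toLp 2 v)) = pureState (WithLp.toLp 2 (V *ᵥ v)) := by
  have h : ∀ {ι : Type} (v : ι → ℂ),
      pureState (WithLp.toLp 2 v) = Matrix.vecMulVec v (star v) := fun v => rfl
  rw [h, h, conjBy_apply, Matrix.mul_vecMulVec, Matrix.vecMulVec_mul, Matrix.star_mulVec]

lemma mass_sqrt_smul_mulVec {ι κ : Type} [Fintype ι] [Fintype κ] {c : ℝ} (hc : 0 ≤ c)
    (V : Matrix κ ι ℂ) (v : ι → ℂ) :
    mass ((((√c : ℝ) : ℂ) • V) *ᵥ v) = c * mass (V *ᵥ v) := by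
  simp only [mass, Matrix.smul_mulVec, Pi.smul_apply, smul_eq_mul, norm_mul, mul_pow,
    Finset.mul_sum, Complex.norm_real, Real.norm_eq_abs, sq_abs, Real.sq_sqrt hc]

lemma isometry_mul {ι κ μ : Type} [Fintype κ] [Fintype μ] [DecidableEq ι] [DecidableEq κ]
    {U : Matrix μ κ ℂ} {V : Matrix κ ι ℂ} (hU : Uᴴ * U = 1) (hV : Vᴴ * V = 1) :
    (U * V)ᴴ * (U * V) = 1 := by
  rw [Matrix.conjTranspose_mul, Matrix.mul_assoc, ← Matrix.mul_assoc _ _ V, hU, Matrix.one_mul, hV]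

lemma mass_isometry_mulVec {ι κ : Type} [Fintype ι] [Fintype κ] [DecidableEq ι]
    {V : Matrix κ ι ℂ} (hV : Vᴴ * V = 1) (v : ι → ℂ) : mass (V *ᵥ v) = mass v := by
  rw [mass_mulVec, hV, Matrix.one_mulVec, mass_eq_dotProduct]

/-- Either noise of rate one has Kraus operators each of which reveals the query input: those with
`z j = x` have the projector onto the query input `x` as the sum of their Gram matrices. -/
theorem exists_kraus_completeNoise (n k : ℕ) (N : Noise) :
    ∃ (J : Type) (_ : Fintype J) (z : J → Fin n) (E : J → Op (Query n k)),
      (∀ ρ, completeNoise n k N ρ = ∑ j, conjBy (E j) ρ) ∧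
      ∀ x, ∑ j with z j = x, (E j)ᴴ * E j
        = Matrix.diagonal fun i : Query n k => if i.1 = x then (1 : ℂ) else 0 := by
  cases N with
  | dephasing =>
    refine ⟨Fin n, inferInstance, id,
      fun x => Matrix.single x x (1 : ℂ) ⊗ₖ (1 : Op (Bits k)), fun ρ => ?_, fun x => ?_⟩
    · simp [completeNoise, completeDephasing]
    · have h : (Finset.univ.filter fun j : Fin n => id j = x) = {x} := by ext; simp
      rw [h, Finset.sum_singleton, Matrix.conjTranspose_kronecker, ← Matrix.mul_kronecker_mul]
      ext ⟨a, y⟩ ⟨b, y'⟩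
      simp [Matrix.diagonal_apply, Matrix.single_apply, Matrix.one_apply]
      grind
  | depolarizing =>
    -- The query register is measured in the standard basis and refilled with a random basis state.
    have hc : (0 : ℝ) ≤ ((n : ℝ) * 2 ^ k)⁻¹ := by positivity
    refine ⟨Query n k × Query n k, inferInstance, fun j => j.1.1,
      fun j => ((√(((n : ℝ) * 2 ^ k)⁻¹) : ℝ) : ℂ) • Matrix.single j.2 j.1 (1 : ℂ),
      fun ρ => ?_, fun x => ?_⟩
    · simp only [conjBy_sqrt_smul hc, ← Finset.smul_sum, conjBy_apply,
        Fintype.sum_prod_type (α₁ := Query n k), Matrix.conjTranspose_single,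
        Matrix.single_mul_mul_single]
      simp only [one_mul, star_one, mul_one, Matrix.sum_single_eq_diagonal]
      ext a b
      simp only [completeNoise, completeDepolarizing, LinearMap.smulRight_apply, Matrix.smul_apply,
        Matrix.traceLinearMap_apply, Matrix.sum_apply, Matrix.trace, Matrix.diag_apply,
        Matrix.one_apply, Matrix.diagonal_apply, smul_eq_mul]
      split_ifs
      · push_cast
        ring
      · simp
    · have hn : (n : ℂ) ≠ 0 := by
        exact_mod_cast (Fin.pos x).ne'
      have h2 : ((√(((n : ℝ) * 2 ^ k)⁻¹) : ℝ) : ℂ) * ((√(((n : ℝ) * 2 ^ k)⁻¹) : ℝ) : ℂ)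
          = ((n : ℂ) * 2 ^ k)⁻¹ := by
        rw [← Complex.ofReal_mul, Real.mul_self_sqrt hc]
        push_cast
        rfl
      simp only [Matrix.conjTranspose_smul, Matrix.conjTranspose_single, Matrix.smul_mul,
        Matrix.mul_smul, Matrix.single_mul_single_same, smul_smul, RCLike.star_def,
        Complex.conj_ofReal, h2, map_one, mul_one, ← Finset.smul_sum, Finset.sum_filter,
        Fintype.sum_prod_type (α₁ := Query n k)]
      have h3 : ∀ c : Query n k, ∑ d : Query n k, (if c.1 = x then
          Matrix.single c c (1 : ℂ) else 0)
          = Matrix.single c c (if c.1 = x then (n : ℂ) * 2 ^ k else 0) := by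
        intro c
        split_ifs <;> simp
      simp only [h3, Matrix.sum_single_eq_diagonal]
      ext a b
      simp only [Matrix.smul_apply, Matrix.diagonal_apply, smul_eq_mul]
      split_ifs
      · exact inv_mul_cancel₀ (mul_ne_zero hn (pow_ne_zero k two_ne_zero))
      · simp
      · simp

/-! ### Trajectories of a noisy computation -/

lemma tensorId_conjBy {ι κ W : Type} [Fintype ι] [Fintype W] [DecidableEq W] (V : Matrix κ ι ℂ)
    (ρ : Op (ι × W)) : tensorId (conjBy V) ρ = conjBy (V ⊗ₖ (1 : Matrix W W ℂ)) ρ := by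
  ext ⟨a, c⟩ ⟨b, d⟩
  simp only [tensorId, conjBy_apply, Matrix.of_apply, Matrix.mul_apply, Matrix.conjTranspose_apply,
    Fintype.sum_prod_type, Matrix.kroneckerMap_apply, Matrix.one_apply]
  simp only [mul_ite, mul_one, mul_zero, ite_mul, zero_mul, Finset.sum_ite_eq, Finset.mem_univ,
    if_true]
  refine Finset.sum_congr rfl fun x _ => ?_
  rw [Finset.sum_eq_single d (by simp +contextual [eq_comm]) (by simp)]
  simp

lemma massAt_eq_dotProduct {n k : ℕ} {W : Type} [Fintype W] [DecidableEq W] (x : Fin n)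
    (v : Query n k × W → ℂ) :
    massAt x v = (star v ⬝ᵥ ((Matrix.diagonal (fun i : Query n k => if i.1 = x then (1 : ℂ) else 0)
      ⊗ₖ (1 : Matrix W W ℂ)) *ᵥ v)).re := by
  rw [← Matrix.diagonal_one, Matrix.diagonal_kronecker_diagonal]
  simp only [massAt, dotProduct, Matrix.mulVec_diagonal, Complex.re_sum, Pi.star_apply, mul_one,
    ite_mul, one_mul, zero_mul, mul_ite, mul_zero]
  refine Finset.sum_congr rfl fun i _ => ?_
  split_ifs
  · rw [← Complex.normSq_eq_norm_sq, RCLike.star_def, mul_comm, Complex.mul_conj,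
      Complex.ofReal_re]
  · rfl

/-- A family of density operators, one for each function, is a mixture of pure trajectories that
have total squared norm at most one and potential at most `b` on average over the functions. -/
def HasUnraveling {n k : ℕ} {ι : Type} [Fintype ι] (w : Bits k)
    (ρ : (Fin n → Bits k) → Op ι) (b : ℝ) : Prop :=
  ∃ (E : Type) (_ : Fintype E) (K : E → Finset (Fin n))
    (ψ : E → (Fin n → Bits k) → ι → ℂ),
    (∀ f, ρ f = ∑ e, pureState (WithLp.toLp 2 (ψ e f))) ∧
    ∑ e, ∑ f, mass (ψ e f) ≤ (2 ^ k) ^ n ∧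
    ∑ e, potential w (K e) (ψ e) ≤ b * (2 ^ k) ^ n

lemma hasUnraveling_pureState {n k : ℕ} {ι : Type} [Fintype ι] (w : Bits k)
    {ψ : EuclideanSpace ℂ ι} (hψ : ‖ψ‖ = 1) :
    HasUnraveling w (fun _ : Fin n → Bits k => pureState ψ) 0 := by
  refine ⟨Unit, inferInstance, fun _ => ∅, fun _ _ => ψ, fun f => by simp, ?_, ?_⟩
  · have h : mass (ψ : ι → ℂ) = 1 := by
      rw [mass, ← EuclideanSpace.norm_sq_eq, hψ, one_pow]
    simp [h]
  · simp [potential, deadMass, hybridGap, mass]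

/-- One noisy query, followed by the isometry `V₀` if no error has occurred and by `V₁`
otherwise. -/
theorem HasUnraveling.query {n k : ℕ} {W κ : Type} [Fintype W] [DecidableEq W] [Fintype κ]
    {w : Bits k} {N : Noise} {p : ℝ} (hp : 0 < p) (hp1 : p ≤ 1)
    {V₀ V₁ : Matrix κ (Query n k × W) ℂ} (hV₀ : V₀ᴴ * V₀ = 1) (hV₁ : V₁ᴴ * V₁ = 1)
    {ρ : (Fin n → Bits k) → Op (Query n k × W)} {b : ℝ} (h : HasUnraveling w ρ b) :
    HasUnraveling w (fun f =>
      ((1 - p : ℝ) : ℂ) • conjBy V₀ (tensorId (oracleChannel f) (ρ f))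
        + (p : ℂ) • conjBy V₁ (tensorId (completeNoise n k N) (tensorId (oracleChannel f) (ρ f))))
      (b + 32 / (p * 2 ^ k)) := by
  obtain ⟨E, _, K, ψ, hρ, hmass, hpot⟩ := h
  obtain ⟨J, _, z, F, hF, hFz⟩ := exists_kraus_completeNoise n k N
  have hp0 : 0 ≤ 1 - p := by linarith
  let A₀ : Matrix κ (Query n k × W) ℂ := ((√(1 - p) : ℝ) : ℂ) • V₀
  let A : J → Matrix κ (Query n k × W) ℂ :=
    fun j => ((√p : ℝ) : ℂ) • (V₁ * (F j ⊗ₖ (1 : Matrix W W ℂ)))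
  have hA₀ : ∀ v, mass (A₀ *ᵥ v) ≤ (1 - p) * mass v := fun v => by
    rw [mass_sqrt_smul_mulVec hp0, mass_isometry_mulVec hV₀]
  have hA : ∀ x v, ∑ j with z j = x, mass (A j *ᵥ v) ≤ p * massAt x v := fun x v => by
    refine le_of_eq ?_
    simp only [A, mass_sqrt_smul_mulVec hp.le, ← Finset.mul_sum, ← Matrix.mulVec_mulVec,
      mass_isometry_mulVec hV₁]
    rw [massAt_eq_dotProduct, ← hFz x]
    simp only [mass_mulVec, Matrix.conjTranspose_kronecker, ← Matrix.mul_kronecker_mul,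
      Matrix.conjTranspose_one, Matrix.one_mul]
    rw [← Complex.re_sum, ← dotProduct_sum, ← Matrix.sum_mulVec]
    congr 4
    ext i i'
    simp [Matrix.sum_apply, Finset.sum_mul]
  refine ⟨E × Option J, inferInstance,
    fun e => e.2.elim (K e.1) fun j => insert (z j) (K e.1),
    fun e f => e.2.elim A₀ A *ᵥ queryVec f (ψ e.1 f), fun f => ?_, ?_, ?_⟩
  · have hN : ∀ σ : Op (Query n k × W),
        tensorId (completeNoise n k N) σ = ∑ j, conjBy (F j ⊗ₖ (1 : Matrix W W ℂ)) σ := fun σ => by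
      simp only [← tensorId_conjBy]
      ext a b
      simp [tensorId, hF, Matrix.sum_apply]
    simp only [hN, oracleChannel, tensorId_conjBy, hρ, Fintype.sum_prod_type, Fintype.sum_option,
      Option.elim_none, Option.elim_some,
      ← conjBy_pureState, A₀, A, conjBy_sqrt_smul hp0, conjBy_sqrt_smul hp.le, map_sum,
      ← oracleMatrix_mulVec, Finset.sum_add_distrib, ← Finset.smul_sum, ← conjBy_comp]
    rw [Finset.sum_comm]
  · refine le_trans ?_ hmass
    rw [Fintype.sum_prod_type]
    refine Finset.sum_le_sum fun e _ => ?_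
    rw [Finset.sum_comm]
    refine Finset.sum_le_sum fun f _ => ?_
    rw [Fintype.sum_option]
    have h2 := sum_mass_mulVec_le hA (fun _ => {()}) fun _ => queryVec f (ψ e f)
    simp only [Finset.sum_singleton, sum_massAt] at h2
    refine (add_le_add (hA₀ _) h2).trans_eq ?_
    rw [mass_queryVec]
    ring
  · have h2 : ∑ e, (potential w (K e) (fun f => A₀ *ᵥ queryVec f (ψ e f))
        + ∑ j, potential w (insert (z j) (K e)) (fun f => A j *ᵥ queryVec f (ψ e f)))
        ≤ ∑ e, (potential w (K e) (ψ e) + 32 / (p * 2 ^ k) * ∑ f, mass (ψ e f)) :=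
      Finset.sum_le_sum fun e _ => potential_query_le hp hp1 hA₀ hA w (K e) (ψ e)
    simp only [Fintype.sum_prod_type, Fintype.sum_option, Option.elim_none, Option.elim_some]
    refine h2.trans ?_
    rw [Finset.sum_add_distrib, ← Finset.mul_sum, add_mul]
    gcongr

lemma Measurement.re_trace_proj_mul_pureState {α ι : Type} [Fintype α] [Fintype ι]
    [DecidableEq ι] (M : Measurement α ι) (a : α) (v : ι → ℂ) :
    ((M.proj a * pureState (WithLp.toLp 2 v)).trace).re = mass (M.proj a *ᵥ v) := by
  have h : pureState (WithLp.toLp 2 v) = Matrix.vecMulVec v (star v) := rfl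
  have hs : (M.proj a)ᴴ = M.proj a := (M.isProj a).isSelfAdjoint
  have hi : M.proj a * M.proj a = M.proj a := (M.isProj a).isIdempotentElem
  rw [mass_mulVec, hs, hi, h, Matrix.mul_vecMulVec, Matrix.trace_vecMulVec, dotProduct_comm]

lemma Measurement.sum_mass_proj {α ι : Type} [Fintype α] [Fintype ι] [DecidableEq ι]
    (M : Measurement α ι) (v : ι → ℂ) : ∑ a, mass (M.proj a *ᵥ v) = mass v := by
  simp only [← M.re_trace_proj_mul_pureState]
  rw [← Complex.re_sum, ← Matrix.trace_sum, ← Finset.sum_mul, M.complete, one_mul,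
    mass_eq_dotProduct]
  have h : pureState (WithLp.toLp 2 v) = Matrix.vecMulVec v (star v) := rfl
  rw [h, Matrix.trace_vecMulVec, dotProduct_comm]

/-- The final measurement succeeds with a probability that exceeds the potential by at most the
probability `2 / 2 ^ k`. -/
theorem HasUnraveling.sum_prob_le {n k : ℕ} {ι : Type} [Fintype ι] [DecidableEq ι] {w : Bits k}
    {ρ : (Fin n → Bits k) → Op ι} {b : ℝ} (h : HasUnraveling w ρ b)
    (M : Measurement (Fin n) ι) :
    (∑ f, M.prob (ρ f) fun x => f x = w) / (2 ^ k) ^ n ≤ b + 2 / 2 ^ k := by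
  obtain ⟨E, _, K, ψ, hρ, hmass, hpot⟩ := h
  rw [div_le_iff₀ (by positivity)]
  have h1 : ∑ f, M.prob (ρ f) (fun x => f x = w)
      = ∑ e, ∑ f, ∑ x with f x = w, mass (M.proj x *ᵥ ψ e f) := by
    rw [Finset.sum_comm]
    refine Finset.sum_congr rfl fun f _ => ?_
    rw [Finset.sum_comm, Measurement.prob]
    refine Finset.sum_congr rfl fun x _ => ?_
    rw [hρ, Finset.mul_sum, Matrix.trace_sum, Complex.re_sum]
    simp only [M.re_trace_proj_mul_pureState]
  have h2 := Finset.sum_le_sum fun e (_ : e ∈ Finset.univ) =>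
    sum_mass_proj_le_potential M.sum_mass_proj w (K e) (ψ e)
  rw [Finset.sum_add_distrib, ← Finset.mul_sum] at h2
  rw [h1, add_mul]
  refine h2.trans ?_
  gcongr

/-! ### Search algorithms -/

lemma ConcealingAlgorithm.hasUnraveling_state {n k : ℕ} (A : ConcealingAlgorithm n k) (N : Noise)
    {p : ℝ} (hp : 0 < p) (hp1 : p ≤ 1) (w : Bits k) (t : ℕ) (ht : t ≤ A.queries) :
    HasUnraveling w (fun f => A.state N p f t ht) (t * (32 / (p * 2 ^ k))) := by
  induction t with
  | zero =>
    simpa [ConcealingAlgorithm.state] using hasUnraveling_pureState w A.norm_init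
  | succ t ih =>
    have hU := Matrix.mem_unitaryGroup_iff'.1 (A.unitary ⟨t, ht⟩).2
    have h := (ih (Nat.le_of_succ_le ht)).query (N := N) hp hp1 hU hU
    convert h using 1
    · funext f
      rw [ConcealingAlgorithm.state, ← map_smul, ← map_smul, ← map_add]
      rfl
    · push_cast
      ring

/-- The isometry that appends to the workspace a qubit in the basis state `b`. -/
def appendQubit (ι : Type) [DecidableEq ι] (l : ℕ) (b : Bool) :
    Matrix (ι × (Fin (l + 1) → Bool)) (ι × (Fin l → Bool)) ℂ :=
  Matrix.of fun a c => if (a.1, Fin.init a.2) = c ∧ a.2 (Fin.last l) = b then 1 else 0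

lemma appendQubit_isometry (ι : Type) [Fintype ι] [DecidableEq ι] (l : ℕ) (b : Bool) :
    (appendQubit ι l b)ᴴ * appendQubit ι l b = 1 := by
  have h : ∀ (a : ι × (Fin (l + 1) → Bool)) (c : ι × (Fin l → Bool)),
      ((a.1, Fin.init a.2) = c ∧ a.2 (Fin.last l) = b)
        ↔ a = (c.1, (Fin.snoc c.2 b : Fin (l + 1) → Bool)) := by
    rintro ⟨x, u⟩ c
    constructor
    · rintro ⟨rfl, rfl⟩
      simp
    · intro h
      obtain ⟨rfl, rfl⟩ := Prod.mk.inj h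
      simp
  ext c d
  simp only [Matrix.mul_apply, Matrix.conjTranspose_apply, appendQubit, Matrix.of_apply, h,
    mul_ite, mul_one, mul_zero, Finset.sum_ite_eq', Finset.mem_univ, if_true]
  by_cases hcd : c = d
  · subst hcd
    simp
  · rw [Matrix.one_apply_ne hcd, if_neg, star_zero]
    intro h2
    obtain ⟨h3, h4⟩ := Prod.mk.inj h2
    exact hcd (Prod.ext h3.symm ((Fin.snoc_left_injective (α := fun _ => Bool) b h4).symm))

/-- Flagging a block with `b` amounts to appending a qubit in the state `b`. -/
lemma flagToWorkspace_tensorId_appendFlag {ι κ : Type} [Fintype ι] [DecidableEq ι] {l : ℕ}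
    (b : Bool) (Φ : Op κ →ₗ[ℂ] Op ι) (ρ : Op (κ × (Fin l → Bool))) :
    flagToWorkspace (tensorId (appendFlag b ∘ₗ Φ) ρ)
      = conjBy (appendQubit ι l b) (tensorId Φ ρ) := by
  ext a c
  have h : flagToWorkspace (tensorId (appendFlag b ∘ₗ Φ) ρ) a c
      = tensorId Φ ρ (a.1, Fin.init a.2) (c.1, Fin.init c.2)
        * Matrix.single b b (1 : ℂ) (a.2 (Fin.last l)) (c.2 (Fin.last l)) := rfl
  rw [h]
  simp only [conjBy_apply, appendQubit, Matrix.mul_apply, Matrix.conjTranspose_apply,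
    Matrix.of_apply, Matrix.single_apply]
  by_cases ha : a.2 (Fin.last l) = b <;> by_cases hc : c.2 (Fin.last l) = b <;>
    simp [ha, hc, @eq_comm _ b]

lemma SignalingAlgorithm.hasUnraveling_state {n k : ℕ} (A : SignalingAlgorithm n k) (N : Noise)
    {p : ℝ} (hp : 0 < p) (hp1 : p ≤ 1) (w : Bits k) (t : ℕ) (ht : t ≤ A.queries) :
    HasUnraveling w (fun f => A.state N p f t ht) (t * (32 / (p * 2 ^ k))) := by
  induction t with
  | zero =>
    simpa [SignalingAlgorithm.state] using hasUnraveling_pureState w A.norm_init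
  | succ t ih =>
    have hU := Matrix.mem_unitaryGroup_iff'.1 (A.unitary ⟨t, ht⟩).2
    have h := (ih (Nat.le_of_succ_le ht)).query (N := N) hp hp1
      (isometry_mul hU (appendQubit_isometry (Query n k) (A.qubits + t) false))
      (isometry_mul hU (appendQubit_isometry (Query n k) (A.qubits + t) true))
    convert h using 1
    · funext f
      have h2 := flagToWorkspace_tensorId_appendFlag false LinearMap.id
        (tensorId (oracleChannel f) (A.state N p f t (Nat.le_of_succ_le ht)))
      have h3 := flagToWorkspace_tensorId_appendFlag true (completeNoise n k N)
        (tensorId (oracleChannel f) (A.state N p f t (Nat.le_of_succ_le ht)))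
      have h4 : ∀ σ : Op (Mem n k (A.qubits + t)), tensorId LinearMap.id σ = σ := fun _ => rfl
      have h5 : flagToWorkspace (tensorId (signalingOracle N p f)
          (A.state N p f t (Nat.le_of_succ_le ht)))
          = ((1 - p : ℝ) : ℂ) • conjBy (appendQubit (Query n k) (A.qubits + t) false)
              (tensorId (oracleChannel f) (A.state N p f t (Nat.le_of_succ_le ht)))
            + (p : ℂ) • conjBy (appendQubit (Query n k) (A.qubits + t) true)
              (tensorId (completeNoise n k N)
                (tensorId (oracleChannel f) (A.state N p f t (Nat.le_of_succ_le ht)))) := by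
        rw [← h3, ← h4 (tensorId (oracleChannel f) _), ← h2]
        rfl
      rw [SignalingAlgorithm.state, h5, map_add, map_smul, map_smul, conjBy_comp, conjBy_comp]
    · push_cast
      ring

lemma le_queries_of_le {k t : ℕ} {p s : ℝ} (hp : 0 < p) (hp1 : p ≤ 1)
    (hs : s ≤ t * (32 / (p * 2 ^ k)) + 2 / 2 ^ k) : 2 ^ k * p * s / 32 - 1 ≤ t := by
  have hm : (0 : ℝ) < 2 ^ k := by positivity
  have h := mul_le_mul_of_nonneg_left hs (by positivity : (0 : ℝ) ≤ 2 ^ k * p)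
  have h2 : (2 : ℝ) ^ k * p * (t * (32 / (p * 2 ^ k)) + 2 / 2 ^ k) = 32 * t + 2 * p := by
    field_simp
  linarith

end NoisySearch

end

theorem mainTheorem2 (n k : ℕ) (w : NoisySearch.Bits k) (N : NoisySearch.Noise)
    (p ε : ℝ) (hp : 0 < p) (hp1 : p ≤ 1) :
    (∀ A : NoisySearch.ConcealingAlgorithm n k, 1 - ε ≤ A.successProb N p w →
      (2 : ℝ) ^ k * p * (1 - ε) / 32 - 1 ≤ (A.queries : ℝ)) ∧
    (∀ A : NoisySearch.SignalingAlgorithm n k, 1 - ε ≤ A.successProb N p w →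
      (2 : ℝ) ^ k * p * (1 - ε) / 32 - 1 ≤ (A.queries : ℝ)) := by
  refine ⟨fun A hA => ?_, fun A hA => ?_⟩
  · exact NoisySearch.le_queries_of_le hp hp1
      (hA.trans ((A.hasUnraveling_state N hp hp1 w _ le_rfl).sum_prob_le A.measurement))
  · exact NoisySearch.le_queries_of_le hp hp1
      (hA.trans ((A.hasUnraveling_state N hp hp1 w _ le_rfl).sum_prob_le A.measurement))
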